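/- **Folk Theorem for Smale plans.** Consider a symmetric Prisoner's Dilemma with moves $c$ (cooperate), $d$ (defect), in which the outcomes $cc, cd, dc, dd$ (the move of player X first) give players X and Y the payoff pairs $(R,R), (S,T), (T,S), (P,P)$, where $T>R>P>S$ and $2R>T+S$. Let $\mathcal S\subset\mathbb R^2$ be the convex hull of these four pairs. The game is repeated, and $s^N=(s^N_X,s^N_Y)=\frac1N\sum_{k=1}^N S^k\in\mathcal S$ is the average of the payoff pairs $S^k$ of the first $N$ rounds. A strategy consists of an initial play together with a plan, which gives a probability of playing $c$ in the next round for every nonempty finite history of outcomes. An outcome sequence for a pair of strategies is a sequence of outcomes in which every move chosen has positive probability given the history. A Smale plan is a function $\pi:\mathcal S\to[0,1]$: a player X using $\pi$ plays $c$ in round $N+1$ with probability $\pi(s^N_X,s^N_Y)$, and a player Y using $\pi$ plays $c$ with probability $\pi(s^N_Y,s^N_X)$. A player eventually plays a plan if for some $N^*$ the player uses it after all histories of length $N\ge N^*$. A pair of Smale plans $\pi_X,\pi_Y$ is a *strong Nash equilibrium* with payoff $s^*=(s^*_X,s^*_Y)$ if the following hold, whatever the initial plays. (a) If X eventually plays $\pi_X$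 and Y eventually plays $\pi_Y$, then for every outcome sequence $s^N\to s^*$. (b) If Y eventually plays $\pi_Y$, then, regardless of the play of X, every limit point $V$ of the sequence $(s^N)$ of an outcome sequence with $V_X\ge s^*_X$ equals $s^*$. If X eventually plays $\pi_X$, then, regardless of the play of Y, every limit point $V$ of the sequence $(s^N)$ of an outcome sequence with $V_Y\ge s^*_Y$ equals $s^*$. **Theorem.** For every $s^*=(s^*_X,s^*_Y)\in\mathcal S$ with $s^*_X>P$ and $s^*_Y>P$ there is a pair of Smale plans $\pi_X,\pi_Y$ that is a strong Nash equilibrium with payoff $s^*$. -/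

import Mathlib

open Filter Topology

noncomputable section

/-- The payoffs of a symmetric Prisoner's Dilemma: temptation `T`, reward `R`, punishment `P`
and sucker's payoff `S`. -/
structure PrisonersDilemma where
  T : ℝ
  R : ℝ
  P : ℝ
  S : ℝ
  R_lt_T : R < T
  P_lt_R : P < R
  S_lt_P : S < P
  T_add_S_lt : T + S < 2 * R

/-- The two moves: cooperation `c` and defection `d`. -/
inductive Move where
  | c
  | d

/-- An outcome of one round: the move of X, then the move of Y. -/
abbrev Outcome : Type := Move × Move

namespace PrisonersDilemma

variable (G : PrisonersDilemma)

/-- The payoff pair (payoff to X, payoff to Y) of an outcome. -/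
def payoff : Outcome → ℝ × ℝ
  | (Move.c, Move.c) => (G.R, G.R)
  | (Move.c, Move.d) => (G.S, G.T)
  | (Move.d, Move.c) => (G.T, G.S)
  | (Move.d, Move.d) => (G.P, G.P)

/-- The payoff region: the convex hull in the plane of the four payoff pairs. -/
def region : Set (ℝ × ℝ) :=
  convexHull ℝ {(G.R, G.R), (G.S, G.T), (G.T, G.S), (G.P, G.P)}

theorem payoff_mem_region (z : Outcome) : G.payoff z ∈ G.region := by
  apply subset_convexHull
  rcases z with ⟨_ | _, _ | _⟩ <;> simp [payoff]

/-- The average payoff pair over the `n + 1` rounds recorded in a history. -/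
def average {n : ℕ} (h : Fin (n + 1) → Outcome) : ℝ × ℝ :=
  ((n + 1 : ℝ)⁻¹) • ∑ k, G.payoff (h k)

theorem average_mem_region {n : ℕ} (h : Fin (n + 1) → Outcome) : G.average h ∈ G.region := by
  have hc : Convex ℝ G.region := convex_convexHull ℝ _
  have := hc.sum_mem (t := Finset.univ) (w := fun _ : Fin (n + 1) => ((n + 1 : ℝ)⁻¹))
    (z := fun k => G.payoff (h k)) (fun _ _ => by positivity)
    (by
      have : (n + 1 : ℝ) ≠ 0 := by positivity
      simp [this])
    (fun k _ => G.payoff_mem_region (h k))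
  simpa [average, Finset.smul_sum] using this

theorem swap_mem_region {s : ℝ × ℝ} (hs : s ∈ G.region) : s.swap ∈ G.region := by
  have h : (LinearEquiv.prodComm ℝ ℝ ℝ).toLinearMap s ∈
      (LinearEquiv.prodComm ℝ ℝ ℝ).toLinearMap '' G.region := ⟨s, hs, rfl⟩
  rw [region, LinearMap.image_convexHull] at h
  refine convexHull_mono ?_ h
  rintro _ ⟨t, ht, rfl⟩
  simp only [Set.mem_insert_iff, Set.mem_singleton_iff] at ht ⊢
  rcases ht with rfl | rfl | rfl | rfl <;> simp

/-- The average payoff pair, as a point of the payoff region. -/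
def averagePt {n : ℕ} (h : Fin (n + 1) → Outcome) : G.region :=
  ⟨G.average h, G.average_mem_region h⟩

/-- The interchange of the two coordinates on the payoff region. -/
def switch (s : G.region) : G.region := ⟨s.1.swap, G.swap_mem_region s.2⟩

/-- A Smale plan: the probability of cooperating, as a function of the current average payoff
pair, listed with the player's own payoff first. -/
abbrev SmalePlan : Type := G.region → unitInterval

end PrisonersDilemma

/-- A general plan: the probability of cooperating after each nonempty finite history of
outcomes. -/
abbrev Plan : Type := ∀ n : ℕ, (Fin (n + 1) → Outcome) → unitInterval

/-- A strategy: the probability of cooperating in the first round, together with a plan. -/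
structure Strategy where
  initial : unitInterval
  plan : Plan

/-- The history consisting of the first `n + 1` outcomes of a sequence. -/
def history (ω : ℕ → Outcome) (n : ℕ) : Fin (n + 1) → Outcome := fun k => ω k

/-- The probability of a move for a player who cooperates with probability `p`. -/
def moveProb (p : unitInterval) : Move → ℝ
  | Move.c => p
  | Move.d => 1 - p

/-- `ω` is an outcome sequence that can arise when X uses the strategy `σ` and Y uses `τ`: in every
round the moves chosen have positive probability given the history (`ω 0` is the outcome of the
first round). For pure strategies there is exactly one such sequence; in general, the law of
the play is carried by the set of these sequences. -/
def IsOutcomeSequence (σ τ : Strategy) (ω : ℕ → Outcome) : Prop :=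
  (0 < moveProb σ.initial (ω 0).1 ∧ 0 < moveProb τ.initial (ω 0).2) ∧
  ∀ n, 0 < moveProb (σ.plan n (history ω n)) (ω (n + 1)).1 ∧
    0 < moveProb (τ.plan n (history ω n)) (ω (n + 1)).2

namespace PrisonersDilemma

variable (G : PrisonersDilemma)

/-- Player X, using the strategy `σ`, eventually plays the Smale plan `π`. -/
def EventuallyPlaysX (σ : Strategy) (π : G.SmalePlan) : Prop :=
  ∃ N, ∀ n ≥ N, ∀ h : Fin (n + 1) → Outcome, σ.plan n h = π (G.averagePt h)

/-- Player Y, using the strategy `τ`, eventually plays the Smale plan `π`; she applies `π` to the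
average payoff pair with the coordinates interchanged. -/
def EventuallyPlaysY (τ : Strategy) (π : G.SmalePlan) : Prop :=
  ∃ N, ∀ n ≥ N, ∀ h : Fin (n + 1) → Outcome, τ.plan n h = π (G.switch (G.averagePt h))

/-- The sequence of running average payoff pairs; the term of index `n` is the average over the
first `n + 1` rounds. -/
def runningAverage (ω : ℕ → Outcome) (n : ℕ) : ℝ × ℝ := G.average (history ω n)

/-- `V` is a limit point of the sequence of running averages of `ω`. -/
def IsLimitPoint (ω : ℕ → Outcome) (V : ℝ × ℝ) : Prop :=
  MapClusterPt V atTop (G.runningAverage ω)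

/-- The pair of Smale plans `πX` (for X), `πY` (for Y) is a strong Nash equilibrium with
payoff `s`. -/
structure IsStrongNashEquilibrium (πX πY : G.SmalePlan) (s : ℝ × ℝ) : Prop where
  /-- If both players eventually use these plans, then the running averages converge to `s`. -/
  converges : ∀ σ τ : Strategy, G.EventuallyPlaysX σ πX → G.EventuallyPlaysY τ πY →
    ∀ ω, IsOutcomeSequence σ τ ω → Tendsto (G.runningAverage ω) atTop (𝓝 s)
  /-- If Y eventually plays `πY`, then, regardless of the play of X, no limit point other than `s`
  gives X at least `s.1`. -/
  deviationX : ∀ σ τ : Strategy, G.EventuallyPlaysY τ πY →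
    ∀ ω, IsOutcomeSequence σ τ ω → ∀ V, G.IsLimitPoint ω V → s.1 ≤ V.1 → V = s
  /-- If X eventually plays `πX`, then, regardless of the play of Y, no limit point other than `s`
  gives Y at least `s.2`. -/
  deviationY : ∀ σ τ : Strategy, G.EventuallyPlaysX σ πX →
    ∀ ω, IsOutcomeSequence σ τ ω → ∀ V, G.IsLimitPoint ω V → s.2 ≤ V.2 → V = s

end PrisonersDilemma

end

/-! Let `u` be the displacement of the running average from `s`. Y punishes (defects) whenever `u`
leaves a thin-complement wedge `gauge ε u ≤ 0` to the left of `s`; X does the same with the wedge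
below `s`.

Deterrence: when Y defects, the round pays `(S,T)` or `(P,P)`, both in Y's wedge for small `ε`. The
gauge is subadditive, so the gauge of the summed displacements stays bounded above, and every limit
point lies in the wedge, which meets `s.1 ≤ V.1` only at `s`.

Convergence: if both follow the rule, the next payoff never points away from `s`, so Blackwell's
argument applies. Where both wedges overlap the rule leaves freedom, and a prearranged outcome is
played; one exists because `s` lies in the convex hull (`exists_outcome`). -/

namespace FolkTheorem

/-! ### Averages of bounded sequences in the plane. -/

/-- A positively homogeneous convex function whose sublevel set `{gauge ε ≤ 0}` is a wedge that
meets the half plane `{0 ≤ u.1}` only in the origin. -/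
def gauge (ε : ℝ) (u : ℝ × ℝ) : ℝ := u.1 + ε * |u.2|

theorem gauge_add_le {ε : ℝ} (hε : 0 ≤ ε) (u v : ℝ × ℝ) :
    gauge ε (u + v) ≤ gauge ε u + gauge ε v := by
  have := mul_le_mul_of_nonneg_left (abs_add_le u.2 v.2) hε
  simp only [gauge, Prod.fst_add, Prod.snd_add]
  linarith

theorem gauge_smul (ε : ℝ) {r : ℝ} (hr : 0 ≤ r) (u : ℝ × ℝ) :
    gauge ε (r • u) = r * gauge ε u := by
  simp only [gauge, Prod.smul_fst, Prod.smul_snd, smul_eq_mul, abs_mul, abs_of_nonneg hr]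
  ring

theorem continuous_gauge (ε : ℝ) : Continuous (gauge ε) := by
  unfold gauge
  fun_prop

theorem gauge_le {ε M : ℝ} (hε : 0 ≤ ε) {u : ℝ × ℝ} (hu : ‖u‖ ≤ M) : gauge ε u ≤ M + ε * M := by
  have h1 : u.1 ≤ M := (le_abs_self _).trans ((norm_fst_le u).trans hu)
  have h2 : |u.2| ≤ M := (norm_snd_le u).trans hu
  have := mul_le_mul_of_nonneg_left h2 hε
  simp only [gauge]
  linarith

theorem eq_zero_of_gauge_nonpos {ε : ℝ} (hε : 0 < ε) {u : ℝ × ℝ} (hu : gauge ε u ≤ 0)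
    (h : 0 ≤ u.1) : u = 0 := by
  simp only [gauge] at hu
  have h2 : 0 ≤ ε * |u.2| := by positivity
  have h3 : ε * |u.2| = 0 := by linarith
  have h4 : u.2 = 0 := by simpa [hε.ne'] using h3
  exact Prod.ext (by simp; linarith) h4

/-- If the partial sums with positive gauge are followed by increments of nonpositive gauge, then
the limit points of the averages have nonpositive gauge. -/
theorem gauge_nonpos_of_mapClusterPt {ε M : ℝ} (hε : 0 ≤ ε) {w : ℕ → ℝ × ℝ}
    (hM : ∀ n, ‖w n‖ ≤ M) {N : ℕ}
    (h : ∀ n ≥ N, 0 < gauge ε (∑ k ∈ Finset.range (n + 1), w k) → gauge ε (w (n + 1)) ≤ 0)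
    {V : ℝ × ℝ}
    (hV : MapClusterPt V atTop fun n : ℕ => ((n + 1 : ℝ)⁻¹) • ∑ k ∈ Finset.range (n + 1), w k) :
    gauge ε V ≤ 0 := by
  set E : ℕ → ℝ × ℝ := fun n => ∑ k ∈ Finset.range (n + 1), w k with hE
  obtain ⟨B, hB⟩ : ∃ B, ∀ n ≥ N, gauge ε (E n) ≤ B := by
    -- The gauge can rise only from a nonpositive value, and then by at most `M + ε * M`.
    refine ⟨max (gauge ε (E N)) (M + ε * M), fun n hn => ?_⟩
    induction n, hn using Nat.le_induction with
    | base => exact le_max_left _ _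
    | succ n hn ih =>
      have hs : E (n + 1) = E n + w (n + 1) := Finset.sum_range_succ _ _
      have hadd := gauge_add_le hε (E n) (w (n + 1))
      rw [← hs] at hadd
      rcases lt_or_ge 0 (gauge ε (E n)) with hp | hp
      · linarith [h n hn hp]
      · refine le_trans ?_ (le_max_right _ _)
        linarith [gauge_le hε (hM (n + 1))]
  by_contra! hpos
  have hlim : Tendsto (fun n : ℕ => B * ((n + 1 : ℝ)⁻¹)) atTop (𝓝 0) := by
    simpa [one_div] using (tendsto_one_div_add_atTop_nhds_zero_nat (𝕜 := ℝ)).const_mul B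
  have hfreq := hV.frequently
    ((continuous_gauge ε).continuousAt.eventually_const_lt (half_lt_self hpos))
  have hev := (hlim.eventually_lt_const (half_pos hpos)).and (eventually_ge_atTop N)
  obtain ⟨n, hn, hn', hN⟩ := (hfreq.and_eventually hev).exists
  rw [gauge_smul ε (by positivity)] at hn
  have := mul_le_mul_of_nonneg_right (hB n hN) (by positivity : (0 : ℝ) ≤ (n + 1 : ℝ)⁻¹)
  linarith

/-- Blackwell's approachability argument for a point: bounded increments which never point away
from the origin have averages converging to zero. -/
theorem tendsto_average_zero {M : ℝ} {w : ℕ → ℝ × ℝ} (hM : ∀ n, ‖w n‖ ≤ M) {N : ℕ}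
    (h : ∀ n ≥ N, (∑ k ∈ Finset.range (n + 1), w k).1 * (w (n + 1)).1 +
      (∑ k ∈ Finset.range (n + 1), w k).2 * (w (n + 1)).2 ≤ 0) :
    Tendsto (fun n : ℕ => ((n + 1 : ℝ)⁻¹) • ∑ k ∈ Finset.range (n + 1), w k) atTop (𝓝 0) := by
  set E : ℕ → ℝ × ℝ := fun n => ∑ k ∈ Finset.range (n + 1), w k with hE
  -- The cross term is nonpositive and each coordinate of an increment is at most `M` in the sup
  -- norm, so the squared length grows by at most `2 * M ^ 2` per round.
  obtain ⟨B, hB⟩ : ∃ B, ∀ n ≥ N, (E n).1 ^ 2 + (E n).2 ^ 2 ≤ B + 2 * M ^ 2 * (n + 1) := by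
    refine ⟨(E N).1 ^ 2 + (E N).2 ^ 2, fun n hn => ?_⟩
    induction n, hn using Nat.le_induction with
    | base => nlinarith [sq_nonneg M, mul_nonneg (sq_nonneg M) (Nat.cast_nonneg (α := ℝ) N)]
    | succ n hn ih =>
      have hs : E (n + 1) = E n + w (n + 1) := Finset.sum_range_succ _ _
      have h1 : (w (n + 1)).1 ^ 2 ≤ M ^ 2 :=
        sq_le_sq' (abs_le.1 ((norm_fst_le _).trans (hM _))).1
          (abs_le.1 ((norm_fst_le _).trans (hM _))).2
      have h2 : (w (n + 1)).2 ^ 2 ≤ M ^ 2 :=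
        sq_le_sq' (abs_le.1 ((norm_snd_le _).trans (hM _))).1
          (abs_le.1 ((norm_snd_le _).trans (hM _))).2
      have h3 : (E n).1 * (w (n + 1)).1 + (E n).2 * (w (n + 1)).2 ≤ 0 := h n hn
      rw [hs, Prod.fst_add, Prod.snd_add]
      push_cast
      linarith
  have hinv : Tendsto (fun n : ℕ => ((n + 1 : ℝ)⁻¹)) atTop (𝓝 0) := by
    simpa [one_div] using tendsto_one_div_add_atTop_nhds_zero_nat (𝕜 := ℝ)
  have hbound : Tendsto (fun n : ℕ => B * ((n + 1 : ℝ)⁻¹) ^ 2 + 2 * M ^ 2 * ((n + 1 : ℝ)⁻¹))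
      atTop (𝓝 0) := by
    simpa using ((hinv.pow 2).const_mul B).add (hinv.const_mul (2 * M ^ 2))
  have hle : ∀ n ≥ N, (((n + 1 : ℝ)⁻¹) * (E n).1) ^ 2 + (((n + 1 : ℝ)⁻¹) * (E n).2) ^ 2 ≤
      B * ((n + 1 : ℝ)⁻¹) ^ 2 + 2 * M ^ 2 * ((n + 1 : ℝ)⁻¹) := by
    intro n hn
    have hn0 : (n + 1 : ℝ) ≠ 0 := by positivity
    have := mul_le_mul_of_nonneg_left (hB n hn) (sq_nonneg ((n + 1 : ℝ)⁻¹))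
    calc _ = ((n + 1 : ℝ)⁻¹) ^ 2 * ((E n).1 ^ 2 + (E n).2 ^ 2) := by ring
      _ ≤ _ := this
      _ = _ := by field_simp
  have hsq : ∀ {f : ℕ → ℝ}, Tendsto (fun n => f n ^ 2) atTop (𝓝 0) → Tendsto f atTop (𝓝 0) := by
    intro f hf
    rw [tendsto_zero_iff_abs_tendsto_zero]
    simpa [Real.sqrt_sq_eq_abs, Function.comp_def] using hf.sqrt
  have h1 : Tendsto (fun n : ℕ => ((n + 1 : ℝ)⁻¹) * (E n).1) atTop (𝓝 0) := by
    refine hsq (squeeze_zero' (Eventually.of_forall fun n => sq_nonneg _) ?_ hbound)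
    filter_upwards [eventually_ge_atTop N] with n hn
    linarith [hle n hn, sq_nonneg (((n + 1 : ℝ)⁻¹) * (E n).2)]
  have h2 : Tendsto (fun n : ℕ => ((n + 1 : ℝ)⁻¹) * (E n).2) atTop (𝓝 0) := by
    refine hsq (squeeze_zero' (Eventually.of_forall fun n => sq_nonneg _) ?_ hbound)
    filter_upwards [eventually_ge_atTop N] with n hn
    linarith [hle n hn, sq_nonneg (((n + 1 : ℝ)⁻¹) * (E n).1)]
  exact h1.prodMk_nhds h2

variable (G : PrisonersDilemma)

/-! ### Geometry of the payoff region. -/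

theorem exists_norm_payoff_sub_le (s : ℝ × ℝ) : ∃ M, ∀ z, ‖G.payoff z - s‖ ≤ M := by
  refine ⟨‖G.payoff (Move.c, Move.c) - s‖ + ‖G.payoff (Move.c, Move.d) - s‖ +
    ‖G.payoff (Move.d, Move.c) - s‖ + ‖G.payoff (Move.d, Move.d) - s‖, ?_⟩
  have h := fun z => norm_nonneg (G.payoff z - s)
  rintro ⟨_ | _, _ | _⟩ <;>
    linarith [h (Move.c, Move.c), h (Move.c, Move.d), h (Move.d, Move.c), h (Move.d, Move.d)]

theorem runningAverage_sub (s : ℝ × ℝ) (ω : ℕ → Outcome) (n : ℕ) :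
    G.runningAverage ω n - s =
      ((n + 1 : ℝ)⁻¹) • ∑ k ∈ Finset.range (n + 1), (G.payoff (ω k) - s) := by
  have hn : (n + 1 : ℝ) ≠ 0 := by positivity
  have h : ∑ k : Fin (n + 1), G.payoff (history ω n k) =
      ∑ k ∈ Finset.range (n + 1), G.payoff (ω k) :=
    Fin.sum_univ_eq_sum_range (fun k => G.payoff (ω k)) (n + 1)
  rw [PrisonersDilemma.runningAverage, PrisonersDilemma.average, h, Finset.sum_sub_distrib,
    smul_sub]
  congr 1
  rw [Finset.sum_const, Finset.card_range, ← Nat.cast_smul_eq_nsmul ℝ, smul_smul]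
  push_cast
  rw [inv_mul_cancel₀ hn, one_smul]

/-- The region lies below a line of negative slope touching it only at `(S,T)`; hence a second
coordinate of at least `T` would force the first down to at most `S`. -/
theorem snd_lt_T {s : ℝ × ℝ} (hs : s ∈ G.region) (hX : G.P < s.1) : s.2 < G.T := by
  have h1 := G.R_lt_T
  have h2 := G.P_lt_R
  have h3 := G.S_lt_P
  have hc : Convex ℝ {v : ℝ × ℝ | (G.T - G.R) * v.1 + (G.T - G.S) * v.2 ≤
      (G.T - G.R) * G.S + (G.T - G.S) * G.T} := by
    refine convex_halfSpace_le ⟨fun v w => ?_, fun r v => ?_⟩ _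
    · simp only [Prod.fst_add, Prod.snd_add]; ring
    · simp only [Prod.smul_fst, Prod.smul_snd, smul_eq_mul]; ring
  have hsub := convexHull_min (s := {(G.R, G.R), (G.S, G.T), (G.T, G.S), (G.P, G.P)}) ?_ hc
  · have : (G.T - G.R) * s.1 + (G.T - G.S) * s.2 ≤ (G.T - G.R) * G.S + (G.T - G.S) * G.T :=
      hsub hs
    by_contra! hT
    nlinarith [mul_pos (sub_pos.2 h1) (sub_pos.2 (h3.trans hX)),
      mul_nonneg (sub_nonneg.2 (h3.trans (h2.trans h1)).le) (sub_nonneg.2 hT)]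
  · rintro v (rfl | rfl | rfl | rfl) <;> simp only [Set.mem_ofPred_eq] <;> nlinarith

/-- For every direction `u`, some outcome has a payoff pair that does not lie strictly beyond the
point `s` of the payoff region in this direction. -/
theorem exists_outcome {s : ℝ × ℝ} (hs : s ∈ G.region) (u : ℝ × ℝ) :
    ∃ z, u.1 * (G.payoff z - s).1 + u.2 * (G.payoff z - s).2 ≤ 0 := by
  by_contra! h
  have hc : Convex ℝ {v : ℝ × ℝ | u.1 * s.1 + u.2 * s.2 < u.1 * v.1 + u.2 * v.2} := by
    refine convex_halfSpace_gt ⟨fun v w => ?_, fun r v => ?_⟩ _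
    · simp only [Prod.fst_add, Prod.snd_add]; ring
    · simp only [Prod.smul_fst, Prod.smul_snd, smul_eq_mul]; ring
  have key : ∀ z, u.1 * s.1 + u.2 * s.2 < u.1 * (G.payoff z).1 + u.2 * (G.payoff z).2 := by
    intro z
    have := h z
    simp only [Prod.fst_sub, Prod.snd_sub] at this
    linarith
  have hsub := convexHull_min (s := {(G.R, G.R), (G.S, G.T), (G.T, G.S), (G.P, G.P)}) ?_ hc
  · have : u.1 * s.1 + u.2 * s.2 < u.1 * s.1 + u.2 * s.2 := hsub hs
    exact lt_irrefl _ this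
  · rintro v (rfl | rfl | rfl | rfl)
    exacts [key (Move.c, Move.c), key (Move.c, Move.d), key (Move.d, Move.c),
      key (Move.d, Move.d)]

theorem exists_pos_mul_le {a b : ℝ} (hb : 0 < b) : ∀ᶠ ε in 𝓝[>] (0 : ℝ), ε * a ≤ b := by
  have h : Tendsto (fun ε : ℝ => ε * a) (𝓝[>] 0) (𝓝 0) := by
    have : Continuous fun ε : ℝ => ε * a := by fun_prop
    simpa using (this.tendsto 0).mono_left nhdsWithin_le_nhds
  exact (h.eventually_lt_const hb).mono fun _ => le_of_lt

/-! ### The wedge rule. -/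

open Classical in
/-- The probability one if `p` holds, and zero otherwise. -/
noncomputable def pureProb (p : Prop) : unitInterval := if p then 1 else 0

/-- The plans are pure, so positive probability determines the move. -/
theorem eq_c_iff_of_moveProb_pos {p : Prop} {m : Move} (h : 0 < moveProb (pureProb p) m) :
    m = Move.c ↔ p := by
  by_cases hp : p <;> cases m <;> simp_all [moveProb, pureProb]

/-- X cooperates in the wedge below `s`, except that in the common part of both wedges he makes his
move in the outcome `b`; the displacement from `s` is `u`. -/
def CooperateX (ε : ℝ) (u : ℝ × ℝ) (b : Outcome) : Prop :=
  gauge ε u.swap ≤ 0 ∧ (gauge ε u ≤ 0 → b.1 = Move.c)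

/-- Y cooperates in the wedge left of `s`, except that in the common part of both wedges she makes
her move in the outcome `b`; the displacement from `s` is `u`. -/
def CooperateY (ε : ℝ) (u : ℝ × ℝ) (b : Outcome) : Prop :=
  gauge ε u ≤ 0 ∧ (gauge ε u.swap ≤ 0 → b.2 = Move.c)

/-- The left side equals `-a * (x + ε * y) - y * (b - ε * a)`. -/
theorem inner_nonpos_of_quadrant {ε a b : ℝ} (ha : 0 ≤ a) (hab : ε * a ≤ b)
    {x y : ℝ} (hy : 0 ≤ y) (hx : 0 < x + ε * y) : x * -a + y * -b ≤ 0 := by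
  nlinarith [mul_nonneg ha hx.le, mul_nonneg hy (sub_nonneg.2 hab)]

/-- The conditions saying that the wedges around `s` are wide enough. -/
structure IsWide (s : ℝ × ℝ) (ε : ℝ) : Prop where
  pos : 0 < ε
  PX : ε * (s.1 - G.P) ≤ s.2 - G.P
  PY : ε * (s.2 - G.P) ≤ s.1 - G.P
  SX : ε * (s.1 - G.S) ≤ G.T - s.2
  SY : ε * (s.2 - G.S) ≤ G.T - s.1
  TX : ε * (G.T - s.1) ≤ s.2 - G.S
  TY : ε * (G.T - s.2) ≤ s.1 - G.S

theorem exists_isWide {s : ℝ × ℝ} (hs : s ∈ G.region) (hX : G.P < s.1) (hY : G.P < s.2) :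
    ∃ ε, IsWide G s ε := by
  have h1 := snd_lt_T G hs hX
  have h2 : s.1 < G.T := snd_lt_T G (G.swap_mem_region hs) hY
  have h3 := G.S_lt_P
  -- Every right-hand side is positive, so all conditions hold for small `ε`.
  have hev : ∀ᶠ ε in 𝓝[>] (0 : ℝ), IsWide G s ε := by
    filter_upwards [self_mem_nhdsWithin,
      exists_pos_mul_le (a := s.1 - G.P) (sub_pos.2 hY),
      exists_pos_mul_le (a := s.2 - G.P) (sub_pos.2 hX),
      exists_pos_mul_le (a := s.1 - G.S) (sub_pos.2 h1),
      exists_pos_mul_le (a := s.2 - G.S) (sub_pos.2 h2),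
      exists_pos_mul_le (a := G.T - s.1) (sub_pos.2 (h3.trans hY)),
      exists_pos_mul_le (a := G.T - s.2) (sub_pos.2 (h3.trans hX))] with ε h0 a b c d e f
    exact ⟨h0, a, b, c, d, e, f⟩
  exact hev.exists

variable {G}

theorem IsWide.gauge_nonpos_of_defectY {s : ℝ × ℝ} {ε : ℝ} (h : IsWide G s ε)
    (hY : G.P < s.2) (hT : s.2 < G.T) {z : Outcome} (hz : z.2 = Move.d) :
    gauge ε (G.payoff z - s) ≤ 0 := by
  obtain ⟨_ | _, _ | _⟩ := z <;> simp only [reduceCtorEq] at hz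
  · have := h.TY
    simp only [gauge, PrisonersDilemma.payoff, Prod.fst_sub, Prod.snd_sub,
      abs_of_pos (sub_pos.2 hT)]
    linarith
  · have := h.PY
    simp only [gauge, PrisonersDilemma.payoff, Prod.fst_sub, Prod.snd_sub,
      abs_of_neg (sub_neg.2 hY)]
    linarith

theorem IsWide.gauge_swap_nonpos_of_defectX {s : ℝ × ℝ} {ε : ℝ} (h : IsWide G s ε)
    (hX : G.P < s.1) (hT : s.1 < G.T) {z : Outcome} (hz : z.1 = Move.d) :
    gauge ε (G.payoff z - s).swap ≤ 0 := by
  obtain ⟨_ | _, _ | _⟩ := z <;> simp only [reduceCtorEq] at hz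
  · have := h.TX
    simp only [gauge, PrisonersDilemma.payoff, Prod.fst_sub, Prod.snd_sub, Prod.fst_swap,
      Prod.snd_swap, abs_of_pos (sub_pos.2 hT)]
    linarith
  · have := h.PX
    simp only [gauge, PrisonersDilemma.payoff, Prod.fst_sub, Prod.snd_sub, Prod.fst_swap,
      Prod.snd_swap, abs_of_neg (sub_neg.2 hX)]
    linarith

/-- If both players use the wedge rule, the payoff pair of the next round does not point away
from `s`. -/
theorem IsWide.inner_nonpos {s : ℝ × ℝ} {ε : ℝ} (h : IsWide G s ε)
    (hX : G.P < s.1) (hY : G.P < s.2) {u : ℝ × ℝ} {b z : Outcome}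
    (hb : u.1 * (G.payoff b - s).1 + u.2 * (G.payoff b - s).2 ≤ 0)
    (hzX : z.1 = Move.c ↔ CooperateX ε u b) (hzY : z.2 = Move.c ↔ CooperateY ε u b) :
    u.1 * (G.payoff z - s).1 + u.2 * (G.payoff z - s).2 ≤ 0 := by
  have hS := G.S_lt_P
  obtain ⟨hε, hPX, hPY, hSX, hSY, -, -⟩ := h
  obtain ⟨x, y⟩ := u
  -- Both wedges give `b`, only X's gives `(c,d)`, only Y's gives `(d,c)`, neither gives `(d,d)`.
  by_cases hx : gauge ε (x, y).swap ≤ 0 <;> by_cases hy : gauge ε (x, y) ≤ 0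
  · have hzb : z = b := by
      simp only [CooperateX, CooperateY, hx, hy, true_and, forall_const] at hzX hzY
      obtain ⟨_ | _, _ | _⟩ := z <;> obtain ⟨_ | _, _ | _⟩ := b <;> simp_all
    rwa [hzb]
  · have hz : z = (Move.c, Move.d) := by
      simp only [CooperateX, CooperateY, hx, hy, true_and, false_and, false_imp_iff] at hzX hzY
      obtain ⟨_ | _, _ | _⟩ := z <;> simp_all
    subst hz
    simp only [gauge, Prod.swap, not_le, PrisonersDilemma.payoff, Prod.fst_sub,
      Prod.snd_sub] at hx hy ⊢
    have hy0 : y ≤ 0 := by linarith [mul_nonneg hε.le (abs_nonneg x)]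
    rw [abs_of_nonpos hy0] at hy
    have := inner_nonpos_of_quadrant (by linarith) hSX (by linarith : 0 ≤ -y) hy
    linarith
  · have hz : z = (Move.d, Move.c) := by
      simp only [CooperateX, CooperateY, hx, hy, true_and, false_and, false_imp_iff] at hzX hzY
      obtain ⟨_ | _, _ | _⟩ := z <;> simp_all
    subst hz
    simp only [gauge, Prod.swap, not_le, PrisonersDilemma.payoff, Prod.fst_sub,
      Prod.snd_sub] at hx hy ⊢
    have hx0 : x ≤ 0 := by linarith [mul_nonneg hε.le (abs_nonneg y)]
    rw [abs_of_nonpos hx0] at hx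
    have := inner_nonpos_of_quadrant (by linarith) hSY (by linarith : 0 ≤ -x) hx
    linarith
  · have hz : z = (Move.d, Move.d) := by
      simp only [CooperateX, CooperateY, hx, hy, false_and] at hzX hzY
      obtain ⟨_ | _, _ | _⟩ := z <;> simp_all
    subst hz
    simp only [gauge, Prod.swap, not_le, PrisonersDilemma.payoff, Prod.fst_sub,
      Prod.snd_sub] at hx hy ⊢
    rcases le_total 0 x with hx0 | hx0
    · rw [abs_of_nonneg hx0] at hx
      have := inner_nonpos_of_quadrant (by linarith) hPY hx0 hx
      linarith
    · rcases le_total 0 y with hy0 | hy0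
      · rw [abs_of_nonneg hy0] at hy
        have := inner_nonpos_of_quadrant (by linarith) hPX hy0 hy
        linarith
      -- `hPX` and `hPY` force `ε ≤ 1`, so the closed negative quadrant is covered by the two
      -- wedges.
      · exfalso
        rw [abs_of_nonpos hx0] at hx
        rw [abs_of_nonpos hy0] at hy
        nlinarith

/-! ### Limit points when one player punishes. -/

theorem mapClusterPt_average_sub {ω : ℕ → Outcome} {V : ℝ × ℝ} (hV : G.IsLimitPoint ω V)
    (s : ℝ × ℝ) : MapClusterPt (V - s) atTop fun n : ℕ =>
      ((n + 1 : ℝ)⁻¹) • ∑ k ∈ Finset.range (n + 1), (G.payoff (ω k) - s) := by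
  have hcont : Continuous fun v : ℝ × ℝ => v - s := by fun_prop
  have := MapClusterPt.continuousAt_comp hcont.continuousAt hV
  simpa only [Function.comp_def, runningAverage_sub] using this

theorem gauge_sum_pos_iff (ε : ℝ) (w : ℕ → ℝ × ℝ) (n : ℕ) :
    0 < gauge ε (∑ k ∈ Finset.range (n + 1), w k) ↔
      0 < gauge ε (((n + 1 : ℝ)⁻¹) • ∑ k ∈ Finset.range (n + 1), w k) := by
  have hn : (0 : ℝ) < (n + 1 : ℝ)⁻¹ := by positivity
  rw [gauge_smul ε hn.le, mul_pos_iff_of_pos_left hn]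

/-- A punishing rule for Y keeps the limit points in the wedge left of `s`. -/
theorem eq_of_limitPoint_of_defectY {s : ℝ × ℝ} {ε : ℝ} (h : IsWide G s ε)
    (hY : G.P < s.2) (hT : s.2 < G.T) {ω : ℕ → Outcome} {N : ℕ}
    (hω : ∀ n ≥ N, 0 < gauge ε (G.runningAverage ω n - s) → (ω (n + 1)).2 = Move.d)
    {V : ℝ × ℝ} (hV : G.IsLimitPoint ω V) (hle : s.1 ≤ V.1) : V = s := by
  obtain ⟨M, hM⟩ := exists_norm_payoff_sub_le G s
  refine sub_eq_zero.1 (eq_zero_of_gauge_nonpos h.pos ?_ (sub_nonneg.2 hle))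
  refine gauge_nonpos_of_mapClusterPt h.pos.le (fun n => hM (ω n)) (N := N) (fun n hn hpos => ?_)
    (mapClusterPt_average_sub hV s)
  rw [gauge_sum_pos_iff, ← runningAverage_sub] at hpos
  exact h.gauge_nonpos_of_defectY hY hT (hω n hn hpos)

/-- A punishing rule for X keeps the limit points in the wedge below `s`. -/
theorem eq_of_limitPoint_of_defectX {s : ℝ × ℝ} {ε : ℝ} (h : IsWide G s ε)
    (hX : G.P < s.1) (hT : s.1 < G.T) {ω : ℕ → Outcome} {N : ℕ}
    (hω : ∀ n ≥ N, 0 < gauge ε (G.runningAverage ω n - s).swap → (ω (n + 1)).1 = Move.d)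
    {V : ℝ × ℝ} (hV : G.IsLimitPoint ω V) (hle : s.2 ≤ V.2) : V = s := by
  obtain ⟨M, hM⟩ := exists_norm_payoff_sub_le G s
  have hswap : ∀ n : ℕ, (((n + 1 : ℝ)⁻¹) • ∑ k ∈ Finset.range (n + 1), (G.payoff (ω k) - s)).swap =
      ((n + 1 : ℝ)⁻¹) • ∑ k ∈ Finset.range (n + 1), (G.payoff (ω k) - s).swap := by
    intro n
    ext <;> simp [Prod.fst_sum, Prod.snd_sum]
  -- The wedge of X is that of Y after exchanging coordinates, which preserves the sup norm.
  have hV' := MapClusterPt.continuousAt_comp continuous_swap.continuousAt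
    (mapClusterPt_average_sub hV s)
  simp only [Function.comp_def, hswap] at hV'
  have h0 : (V - s).swap = 0 := by
    refine eq_zero_of_gauge_nonpos h.pos ?_ (sub_nonneg.2 hle)
    refine gauge_nonpos_of_mapClusterPt h.pos.le (M := M) (fun n => ?_) (N := N)
      (fun n hn hpos => ?_) hV'
    · refine le_trans (le_of_eq ?_) (hM (ω n))
      simp only [Prod.norm_def, Prod.fst_swap, Prod.snd_swap, max_comm]
    · rw [gauge_sum_pos_iff, ← hswap, ← runningAverage_sub] at hpos
      exact h.gauge_swap_nonpos_of_defectX hX hT (hω n hn hpos)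
  exact sub_eq_zero.1 (Prod.swap_injective h0)

/-! ### The equilibrium plans. -/

/-- The plan of X: the wedge rule with outcomes prescribed by `b`. -/
noncomputable def planX (G : PrisonersDilemma) (s : ℝ × ℝ) (ε : ℝ) (b : ℝ × ℝ → Outcome) :
    G.SmalePlan :=
  fun V => pureProb (CooperateX ε (V.1 - s) (b (V.1 - s)))

/-- The plan of Y: the wedge rule with outcomes prescribed by `b`. -/
noncomputable def planY (G : PrisonersDilemma) (s : ℝ × ℝ) (ε : ℝ) (b : ℝ × ℝ → Outcome) :
    G.SmalePlan :=
  fun V => pureProb (CooperateY ε (V.1.swap - s) (b (V.1.swap - s)))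

theorem exists_forall_eq_c_iff_cooperateX {s : ℝ × ℝ} {ε : ℝ} {b : ℝ × ℝ → Outcome}
    {σ τ : Strategy} (hσ : G.EventuallyPlaysX σ (planX G s ε b)) {ω : ℕ → Outcome}
    (hω : IsOutcomeSequence σ τ ω) :
    ∃ N, ∀ n ≥ N, ((ω (n + 1)).1 = Move.c ↔
      CooperateX ε (G.runningAverage ω n - s) (b (G.runningAverage ω n - s))) := by
  obtain ⟨N, hN⟩ := hσ
  refine ⟨N, fun n hn => eq_c_iff_of_moveProb_pos ?_⟩
  have := (hω.2 n).1
  rwa [hN n hn] at this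

theorem exists_forall_eq_c_iff_cooperateY {s : ℝ × ℝ} {ε : ℝ} {b : ℝ × ℝ → Outcome}
    {σ τ : Strategy} (hτ : G.EventuallyPlaysY τ (planY G s ε b)) {ω : ℕ → Outcome}
    (hω : IsOutcomeSequence σ τ ω) :
    ∃ N, ∀ n ≥ N, ((ω (n + 1)).2 = Move.c ↔
      CooperateY ε (G.runningAverage ω n - s) (b (G.runningAverage ω n - s))) := by
  obtain ⟨N, hN⟩ := hτ
  refine ⟨N, fun n hn => eq_c_iff_of_moveProb_pos ?_⟩
  have := (hω.2 n).2
  -- The swap in `planY` cancels the one in `switch`.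
  rwa [hN n hn] at this

theorem Move.eq_d_of_ne_c {m : Move} (h : m ≠ Move.c) : m = Move.d := by
  cases m
  · exact absurd rfl h
  · rfl

end FolkTheorem

open FolkTheorem in
theorem mainTheorem1 (G : PrisonersDilemma) (s : ℝ × ℝ) (hs : s ∈ G.region)
    (hX : G.P < s.1) (hY : G.P < s.2) :
    ∃ πX πY : G.SmalePlan, G.IsStrongNashEquilibrium πX πY s := by
  have hTY : s.2 < G.T := snd_lt_T G hs hX
  have hTX : s.1 < G.T := snd_lt_T G (G.swap_mem_region hs) hY
  obtain ⟨ε, hε⟩ := exists_isWide G hs hX hY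
  -- Both plans share this selection `b`; that is how the players coordinate in the overlap.
  choose b hb using exists_outcome G hs
  refine ⟨planX G s ε b, planY G s ε b, ?_, ?_, ?_⟩
  · intro σ τ hσ hτ ω hω
    obtain ⟨N₁, h₁⟩ := exists_forall_eq_c_iff_cooperateX hσ hω
    obtain ⟨N₂, h₂⟩ := exists_forall_eq_c_iff_cooperateY hτ hω
    obtain ⟨M, hM⟩ := exists_norm_payoff_sub_le G s
    refine tendsto_sub_nhds_zero_iff.1 ?_
    simp only [runningAverage_sub]
    refine tendsto_average_zero (fun n => hM (ω n)) (N := max N₁ N₂) fun n hn => ?_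
    have key := hε.inner_nonpos hX hY (hb _) (h₁ n (le_of_max_le_left hn))
      (h₂ n (le_of_max_le_right hn))
    -- The rule speaks of the average, Blackwell's lemma of the sum; they differ by a positive
    -- factor.
    rw [runningAverage_sub, Prod.smul_fst, Prod.smul_snd, smul_eq_mul, smul_eq_mul, mul_assoc,
      mul_assoc, ← mul_add] at key
    exact nonpos_of_mul_nonpos_right key (by positivity)
  · intro σ τ hτ ω hω V hV hle
    obtain ⟨N, h⟩ := exists_forall_eq_c_iff_cooperateY hτ hω
    exact eq_of_limitPoint_of_defectY hε hY hTY (N := N) (fun n hn hpos =>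
      Move.eq_d_of_ne_c fun hc => hpos.not_ge ((h n hn).1 hc).1) hV hle
  · intro σ τ hσ ω hω V hV hle
    obtain ⟨N, h⟩ := exists_forall_eq_c_iff_cooperateX hσ hω
    exact eq_of_limitPoint_of_defectX hε hX hTX (N := N) (fun n hn hpos =>
      Move.eq_d_of_ne_c fun hc => hpos.not_ge ((h n hn).1 hc).1) hV hle
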